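/- Let $\mathcal P$ be a linear operator and $\mathcal T$ an anti-linear operator on $\mathbb C^n$ with $\mathcal P^2=\mathcal T^2=\mathcal I$ and $\mathcal P\mathcal T=\mathcal T\mathcal P$, and let $\mathcal H$ be a $\mathcal{PT}$-symmetric operator, i.e. a linear operator on $\mathbb C^n$ with $\mathcal H\mathcal P\mathcal T=\mathcal P\mathcal T\mathcal H$. Fix a basis $\{e_j\}$ of $\mathbb C^n$ and let $P,T,H$ be the representation matrices of $\mathcal P,\mathcal T,\mathcal H$ in it ($\mathcal T e_j=\sum_k T_{kj}e_k$, and similarly for $\mathcal P$ and $\mathcal H$); thus $PT\,\overline{PT}=I$ and $H\,PT=PT\,\overline H$, where the bar denotes entrywise complex conjugation. For $k\ge 1$ let $J_k(z)$ be the $k\times k$ Jordan block with $z$ on the diagonal and $1$ on the superdiagonal. Then there exist an invertible matrix $\Psi\in M_n(\mathbb C)$, numbers $p,q\ge 0$, block sizes $m_1,\dots,m_p,k_1,\dots,k_q\ge 1$ with $2\sum_i m_i+\sum_j k_j=n$, non-real numbers $\mu_1,\dots,\mu_p\in\mathbb C\setminus\mathbb R$ and real numbers $\lambda_1,\dots,\lambda_q$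 such that simultaneously $$\Psi^{-1}H\Psi=J:=\bigoplus_{i=1}^p\begin{pmatrix}J_{m_i}(\mu_i)&0\\0&J_{m_i}(\overline{\mu_i})\end{pmatrix}\oplus\bigoplus_{j=1}^q J_{k_j}(\lambda_j)$$ and $$\Psi^{-1}PT\,\overline{\Psi}=K:=\bigoplus_{i=1}^p\begin{pmatrix}0&I_{m_i}\\I_{m_i}&0\end{pmatrix}\oplus\bigoplus_{j=1}^q I_{k_j}.$$ -/

import Mathlib

namespace PTSymm

open Matrix

/-- The finite dimensional complex Hilbert space `ℂⁿ`. -/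
abbrev Cn (n : ℕ) : Type := EuclideanSpace ℂ (Fin n)

/-- A parity operator: a linear operator with `𝒫² = 1`. -/
def IsParity {n : ℕ} (P : Cn n →ₗ[ℂ] Cn n) : Prop :=
  ∀ x, P (P x) = x

/-- A time reversal operator: an anti-linear operator with `𝒯² = 1`. -/
def IsTimeReversal {n : ℕ} (T : Cn n →ₗ⋆[ℂ] Cn n) : Prop :=
  ∀ x, T (T x) = x

/-- `H` is `𝒫𝒯`-symmetric: `P` is a parity operator and `T` a time reversal operator which commute,
and `H` commutes with `𝒫𝒯`. -/
structure IsPTSymmetric {n : ℕ} (P : Cn n →ₗ[ℂ] Cn n) (T : Cn n →ₗ⋆[ℂ] Cn n)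
    (H : Cn n →ₗ[ℂ] Cn n) : Prop where
  parity : IsParity P
  timeReversal : IsTimeReversal T
  commute : ∀ x, P (T x) = T (P x)
  symmetric : ∀ x, H (P (T x)) = P (T (H x))

/-- The representation matrix of an anti-linear operator in the basis `b`: its entries `T_{kj}` are
given by `𝒯 (e_j) = ∑ k, T_{kj} e_k`.  (For linear operators this is `LinearMap.toMatrix b b`.) -/
noncomputable def antilinearMatrix {n : ℕ} (b : Module.Basis (Fin n) ℂ (Cn n))
    (T : Cn n →ₗ⋆[ℂ] Cn n) : Matrix (Fin n) (Fin n) ℂ :=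
  Matrix.of fun k j => b.repr (T (b j)) k

/-- The entrywise complex conjugate (no transpose) of a matrix. -/
noncomputable def conjMatrix {n : ℕ} (A : Matrix (Fin n) (Fin n) ℂ) : Matrix (Fin n) (Fin n) ℂ :=
  A.map (starRingEnd ℂ)

/-- The upper Jordan block `J_k(z)`: `z` on the diagonal and `1` on the superdiagonal. -/
def jordanBlock (k : ℕ) (z : ℂ) : Matrix (Fin k) (Fin k) ℂ :=
  Matrix.of fun i j => if i = j then z else if (i : ℕ) + 1 = (j : ℕ) then 1 else 0

/-- The data of a real Jordan canonical form: `p` conjugate pairs of Jordan blocks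
`J_{m i}(μ i) ⊕ J_{m i}(conj (μ i))` with `μ i` not real, and `q` Jordan blocks
`J_{k j}(lam j)` with `lam j` real. -/
structure JordanData where
  p : ℕ
  q : ℕ
  m : Fin p → ℕ
  k : Fin q → ℕ
  μ : Fin p → ℂ
  lam : Fin q → ℝ
  m_pos : ∀ i, 0 < m i
  k_pos : ∀ j, 0 < k j
  μ_nonreal : ∀ i, (μ i).im ≠ 0

namespace JordanData

/-- The total order of the canonical form. -/
def size (D : JordanData) : ℕ := ∑ i, (D.m i + D.m i) + ∑ j, D.k j

/-- Positions in the block matrices: first the conjugate pairs (each with two halves),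
then the real blocks. -/
abbrev Idx (D : JordanData) : Type :=
  (Σ i : Fin D.p, Fin (D.m i) ⊕ Fin (D.m i)) ⊕ (Σ j : Fin D.q, Fin (D.k j))

/-- The numbering of the positions from `0` to `D.size - 1`, block after block. -/
def idxEquiv (D : JordanData) : D.Idx ≃ Fin D.size :=
  (Equiv.sumCongr
    ((Equiv.sigmaCongrRight fun _ => finSumFinEquiv).trans finSigmaFinEquiv)
    finSigmaFinEquiv).trans finSumFinEquiv

/-- The block diagonal matrix `J`, with blocks `J_{m i}(μ i) ⊕ J_{m i}(conj (μ i))`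
followed by blocks `J_{k j}(lam j)`. -/
noncomputable def J (D : JordanData) : Matrix (Fin D.size) (Fin D.size) ℂ :=
  Matrix.reindex D.idxEquiv D.idxEquiv <|
    fromBlocks
      (blockDiagonal' fun i => fromBlocks
        (jordanBlock (D.m i) (D.μ i)) 0
        0 (jordanBlock (D.m i) (starRingEnd ℂ (D.μ i)))) 0
      0 (blockDiagonal' fun j => jordanBlock (D.k j) (D.lam j : ℂ))

/-- The block diagonal matrix `K`, with blocks `[[0, I], [I, 0]]` at the conjugate pairs
followed by blocks `I` at the real blocks. -/
def K (D : JordanData) : Matrix (Fin D.size) (Fin D.size) ℂ :=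
  Matrix.reindex D.idxEquiv D.idxEquiv <|
    fromBlocks
      (blockDiagonal' fun i => fromBlocks
        (0 : Matrix (Fin (D.m i)) (Fin (D.m i)) ℂ) 1
        1 (0 : Matrix (Fin (D.m i)) (Fin (D.m i)) ℂ)) 0
      0 (blockDiagonal' fun j => (1 : Matrix (Fin (D.k j)) (Fin (D.k j)) ℂ))

end JordanData

end PTSymm

/-! The composite `C = 𝒫𝒯` is an anti-linear involution commuting with `H`, so its fixed vectors
form a real form `W` of `ℂⁿ` on which `H` acts `ℝ`-linearly. As an `ℝ[X]`-module, `W` is a sum of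
cyclic modules `ℝ[X]/(p ^ e)` with `p` irreducible; let `z` be a complex root of `p` and `g` the
generator (`exists_fixed_generators`). If `z` is real, the Jordan chain of `g` is fixed by `C`,
giving blocks `J_e(z)` and `I`. Otherwise `u = (H - conj z) ^ e g` is killed by `(H - z) ^ e`, and
`C u = (H - z) ^ e g`. Thus `C` swaps the chains of `u` and `C u`, giving the paired blocks of `J`
and `K`. By Bézout, `g` lies in the span of the two chains. Linear independence is never checked:
the chains span, and there are at most `n` vectors in them (`JordanData.exists_basis`). -/

/-! ### Real irreducible polynomials and cyclic decomposition. -/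

open Polynomial in
/-- The real polynomial with roots `z` and its complex conjugate. -/
noncomputable def PTSymm.conjPairPoly (z : ℂ) : ℝ[X] := X ^ 2 - C (2 * z.re) * X + C (‖z‖ ^ 2)

open Polynomial in
theorem PTSymm.aeval_conjPairPoly (z : ℂ) : aeval z (PTSymm.conjPairPoly z) = 0 := by
  have h : z ^ 2 - (z + starRingEnd ℂ z) * z + starRingEnd ℂ z * z = 0 := by ring
  rw [Complex.add_conj, Complex.conj_mul'] at h
  simpa [PTSymm.conjPairPoly] using h

-- Up to a unit, `p` is the minimal polynomial over `ℝ` of any of its complex roots. The degree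
-- bound feeds the dimension count.
open Polynomial in
theorem PTSymm.exists_root_of_irreducible {p : ℝ[X]} (hp : Irreducible p) :
    ∃ z : ℂ, (z.im = 0 → p ∣ X - C z.re) ∧ (z.im ≠ 0 → p ∣ PTSymm.conjPairPoly z) ∧
      (if z.im = 0 then 1 else 2) ≤ p.natDegree := by
  obtain ⟨z, hz⟩ : ∃ z : ℂ, aeval z p = 0 :=
    IsAlgClosed.exists_aeval_eq_zero _ p (degree_pos_of_irreducible hp).ne'
  have hm := minpoly.eq_of_irreducible hp hz
  have hdvd : p ∣ minpoly ℝ z := ⟨_, hm.symm⟩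
  refine ⟨z, fun h => hdvd.trans (minpoly.dvd ℝ z ?_),
    fun _ => hdvd.trans (minpoly.dvd ℝ z (PTSymm.aeval_conjPairPoly z)), ?_⟩
  · have : (z.re : ℂ) = z := Complex.ext rfl (by simp [h])
    simp [this]
  · split_ifs with h
    · exact natDegree_pos_iff_degree_pos.2 (degree_pos_of_irreducible hp)
    · have hdeg : p.natDegree = (minpoly ℝ z).natDegree := by
        rw [← hm, natDegree_mul hp.ne_zero (by simpa using hp.ne_zero), natDegree_C, add_zero]
      -- Degree below two would force `z` to be real.
      rw [hdeg, minpoly.two_le_natDegree_iff (Algebra.IsIntegral.isIntegral z)]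
      rintro ⟨r, rfl⟩
      simp at h

open Polynomial in
/-- A finite dimensional real space with an endomorphism is a sum of cyclic subspaces, each
annihilated by a power of an irreducible polynomial, whose dimensions add up. -/
theorem PTSymm.exists_real_cyclic_decomposition {W : Type*} [AddCommGroup W] [Module ℝ W]
    [Module.Finite ℝ W] (f : Module.End ℝ W) :
    ∃ (ι : Type) (_ : Fintype ι) (z : ι → ℂ) (e : ι → ℕ) (g : ι → W),
      (∀ i, (z i).im = 0 → aeval f ((X - C (z i).re) ^ e i) (g i) = 0) ∧
      (∀ i, (z i).im ≠ 0 → aeval f (PTSymm.conjPairPoly (z i) ^ e i) (g i) = 0) ∧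
      (∀ w, ∃ a : ι → ℝ[X], w = ∑ i, aeval f (a i) (g i)) ∧
      ∑ i, (if (z i).im = 0 then 1 else 2) * e i ≤ Module.finrank ℝ W := by
  classical
  have htor : Module.IsTorsion ℝ[X] (Module.AEval' f) := by
    exact Module.AEval.isTorsion_of_finiteDimensional ℝ W f
  obtain ⟨ι, _, p, hp, e, ⟨E⟩⟩ := Module.equiv_directSum_of_isTorsion htor
  choose z hz1 hz2 hz3 using fun i => PTSymm.exists_root_of_irreducible (hp i)
  -- The class of `1` generates each cyclic summand.
  let G : ι → Module.AEval' f := fun i => E.symm (DirectSum.lof ℝ[X] ι _ i (Submodule.Quotient.mk 1))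
  have hkill : ∀ i (q : ℝ[X]), p i ^ e i ∣ q → q • G i = 0 := by
    intro i q hq
    simp only [G]
    rw [← map_smul, ← map_smul, ← Submodule.Quotient.mk_smul,
      (Submodule.Quotient.mk_eq_zero _).2, map_zero, map_zero]
    rw [smul_eq_mul, mul_one]
    exact Ideal.mem_span_singleton.2 hq
  have hspan : ∀ w, ∃ a : ι → ℝ[X], w = ∑ i, a i • G i := by
    intro w
    choose a ha using fun i => Submodule.Quotient.mk_surjective _ (E w i)
    refine ⟨a, E.injective ?_⟩
    simp only [G, map_sum, map_smul, LinearEquiv.apply_symm_apply]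
    rw [← DirectSum.sum_univ_of (E w)]
    refine Finset.sum_congr rfl fun i _ => ?_
    rw [← ha i, ← DirectSum.lof_eq_of ℝ[X], ← map_smul, ← Submodule.Quotient.mk_smul,
      smul_eq_mul, mul_one]
  refine ⟨ι, inferInstance, z, e, fun i => (Module.AEval'.of f).symm (G i), fun i hi => ?_,
    fun i hi => ?_, fun w => ?_, ?_⟩
  · exact (Module.AEval.of_symm_smul _ _ _).symm.trans
      (by rw [hkill i _ (pow_dvd_pow_of_dvd (hz1 i hi) _), map_zero])
  · exact (Module.AEval.of_symm_smul _ _ _).symm.trans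
      (by rw [hkill i _ (pow_dvd_pow_of_dvd (hz2 i hi) _), map_zero])
  · obtain ⟨a, ha⟩ := hspan (Module.AEval'.of f w)
    refine ⟨a, (Module.AEval'.of f).injective ?_⟩
    rw [ha, map_sum]
    rfl
  · have hdim : Module.finrank ℝ W = ∑ i, (p i ^ e i).natDegree := by
      have hfin : ∀ i, Module.Finite ℝ (ℝ[X] ⧸ Ideal.span {p i ^ e i}) := fun i =>
        (AdjoinRoot.powerBasis (pow_ne_zero (e i) (hp i).ne_zero)).finite
      rw [((Module.AEval'.of f).trans (E.restrictScalars ℝ)).finrank_eq]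
      refine (Module.finrank_directSum (R := ℝ) fun i => ℝ[X] ⧸ Ideal.span {p i ^ e i}).trans ?_
      exact Finset.sum_congr rfl fun i _ => finrank_quotient_span_eq_natDegree
    rw [hdim]
    refine Finset.sum_le_sum fun i _ => ?_
    rw [natDegree_pow, mul_comm]
    exact Nat.mul_le_mul_left _ (hz3 i)

namespace PTSymm

/-! ### The real form of an anti-linear involution. -/

section Complex

variable {V : Type*} [AddCommGroup V] [Module ℂ V]

/-- The real subspace fixed by an anti-linear map. -/
noncomputable def fixedSubspace (C : V →ₗ⋆[ℂ] V) : Submodule ℝ V where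
  carrier := {x | C x = x}
  add_mem' hx hy := by simp_all
  zero_mem' := by simp
  smul_mem' r x hx := by
    rw [Set.mem_ofPred_eq] at hx ⊢
    rw [← Complex.coe_smul, map_smulₛₗ, Complex.conj_ofReal, hx]

theorem mem_fixedSubspace {C : V →ₗ⋆[ℂ] V} {x : V} : x ∈ fixedSubspace C ↔ C x = x := Iff.rfl

/-- Every vector is a complex combination of two vectors fixed by an anti-linear involution. -/
theorem exists_fixed_add_I_smul {C : V →ₗ⋆[ℂ] V} (hC : ∀ x, C (C x) = x) (v : V) :
    ∃ x ∈ fixedSubspace C, ∃ y ∈ fixedSubspace C, v = x + Complex.I • y := by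
  have h2 : starRingEnd ℂ 2 = 2 := Complex.conj_ofNat 2
  -- Real and imaginary parts with respect to `C`; `-I / 2` is `1 / (2 I)`.
  refine ⟨(2⁻¹ : ℂ) • (v + C v), ?_, (-(2⁻¹ : ℂ) * Complex.I) • (v - C v), ?_, ?_⟩
  · rw [mem_fixedSubspace, map_smulₛₗ, map_add, hC, add_comm]
    simp [h2]
  · rw [mem_fixedSubspace, map_smulₛₗ, map_sub, hC, ← neg_sub v, smul_neg, ← neg_smul]
    simp [h2]
  · rw [smul_smul, show Complex.I * (-(2⁻¹ : ℂ) * Complex.I) = 2⁻¹ by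
      linear_combination (-(2⁻¹ : ℂ)) * Complex.I_mul_I, ← smul_add, add_add_sub_cancel,
      ← two_smul ℂ v, smul_smul]
    simp

/-- The real-linear map `(x, y) ↦ x + I y` is injective on pairs of fixed vectors, because `C` sends
`x + I y` to `x - I y`. -/
theorem finrank_fixedSubspace_le [FiniteDimensional ℂ V] (C : V →ₗ⋆[ℂ] V) :
    Module.finrank ℝ (fixedSubspace C) ≤ Module.finrank ℂ V := by
  have : FiniteDimensional ℝ V := FiniteDimensional.complexToReal V
  let F : (fixedSubspace C × fixedSubspace C) →ₗ[ℝ] V :=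
    (fixedSubspace C).subtype.coprod
      ((LinearMap.lsmul ℂ V Complex.I).restrictScalars ℝ ∘ₗ (fixedSubspace C).subtype)
  have hF : Function.Injective F := by
    rw [← LinearMap.ker_eq_bot, LinearMap.ker_eq_bot']
    rintro ⟨⟨x, hx⟩, ⟨y, hy⟩⟩ h
    replace h : x + Complex.I • y = 0 := h
    have h' := congrArg C h
    rw [map_add, map_smulₛₗ, hx, hy, map_zero, Complex.conj_I, neg_smul] at h'
    have hx0 : x = 0 := by
      have : (2 : ℂ) • x = 0 := by
        rw [two_smul]
        calc x + x = (x + Complex.I • y) + (x + -(Complex.I • y)) := by abel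
          _ = 0 := by rw [h, h', add_zero]
      simpa using this
    have hy0 : y = 0 := by simpa [hx0] using h
    simp [hx0, hy0]
  have h := LinearMap.finrank_le_finrank_of_injective hF
  rw [Module.finrank_prod, finrank_real_of_complex] at h
  omega

open Polynomial in
theorem coe_aeval_restrict {W : Submodule ℝ V} (H : Module.End ℂ V) (f : Module.End ℝ W)
    (hf : ∀ x, (f x : V) = H x) (q : ℝ[X]) (x : W) :
    (aeval f q x : V) = aeval H (q.map (algebraMap ℝ ℂ)) (x : V) := by
  induction q using Polynomial.induction_on generalizing x with
  | C a => simp [Module.algebraMap_end_apply]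
  | add p q hp hq => simp [hp, hq]
  | monomial n a h =>
    rw [pow_succ, ← mul_assoc, map_mul (aeval f), Polynomial.map_mul, map_mul (aeval H), Module.End.mul_apply,
      Module.End.mul_apply, h, map_X, aeval_X, aeval_X, hf]

open Polynomial in
/-- A complex space with an anti-linear involution and a commuting endomorphism `H` is generated
over `H` by fixed vectors, each annihilated by a power of `H - z` with `z` real or of
`(H - z) (H - conj z)` with `z` not real. -/
theorem exists_fixed_generators [FiniteDimensional ℂ V] {C : V →ₗ⋆[ℂ] V}
    (hC : ∀ x, C (C x) = x) {H : Module.End ℂ V} (hH : ∀ x, C (H x) = H (C x)) :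
    ∃ (ι : Type) (_ : Fintype ι) (z : ι → ℂ) (e : ι → ℕ) (g : ι → V),
      (∀ i, C (g i) = g i) ∧
      (∀ i, (z i).im = 0 → ((H - algebraMap ℂ _ (z i)) ^ e i) (g i) = 0) ∧
      (∀ i, (z i).im ≠ 0 → ((H - algebraMap ℂ _ (z i)) ^ e i *
        (H - algebraMap ℂ _ (starRingEnd ℂ (z i))) ^ e i) (g i) = 0) ∧
      (∀ S : Submodule ℂ V, (∀ x ∈ S, H x ∈ S) → (∀ i, g i ∈ S) → S = ⊤) ∧
      ∑ i, (if (z i).im = 0 then 1 else 2) * e i ≤ Module.finrank ℂ V := by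
  have : FiniteDimensional ℝ V := FiniteDimensional.complexToReal V
  let f : Module.End ℝ (fixedSubspace C) := (H.restrictScalars ℝ).restrict
    (p := fixedSubspace C) (q := fixedSubspace C) fun x (hx : C x = x) =>
      show C (H x) = H x by rw [hH, hx]
  have hf : ∀ x, (f x : V) = H x := fun x => rfl
  obtain ⟨ι, _, z, e, g, h1, h2, h3, h4⟩ := exists_real_cyclic_decomposition f
  refine ⟨ι, inferInstance, z, e, fun i => g i, fun i => (g i).2, fun i hi => ?_, fun i hi => ?_,
    fun S hS hg => ?_, h4.trans (finrank_fixedSubspace_le C)⟩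
  · have h := congrArg Subtype.val (h1 i hi)
    rw [coe_aeval_restrict H f hf] at h
    have hz : ((z i).re : ℂ) = z i := Complex.ext rfl (by simp [hi])
    simpa [hz] using h
  · have h := congrArg Subtype.val (h2 i hi)
    rw [coe_aeval_restrict H f hf] at h
    have hq : (conjPairPoly (z i) ^ e i).map (algebraMap ℝ ℂ) =
        (X - Polynomial.C (z i)) ^ e i * (X - Polynomial.C (starRingEnd ℂ (z i))) ^ e i := by
      rw [← mul_pow, Polynomial.map_pow]
      congr 1
      calc (conjPairPoly (z i)).map (algebraMap ℝ ℂ)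
          = X ^ 2 - Polynomial.C (↑(2 * (z i).re) : ℂ) * X + Polynomial.C (‖z i‖ ^ 2 : ℂ) := by
            simp [conjPairPoly]
        _ = _ := by
            rw [← Complex.add_conj, map_add, ← Complex.mul_conj', map_mul]
            ring
    rw [hq] at h
    simpa using h
  -- An invariant `S` containing the generators contains the real form, which spans `V` over `ℂ`.
  · have hpoly : ∀ (q : ℂ[X]) (x : V), x ∈ S → aeval H q x ∈ S := fun q x hx =>
      aeval_apply_smul_mem_of_le_comap' (A := Module.End ℂ V) hx q H hS
    have hfix : ∀ x ∈ fixedSubspace C, x ∈ S := by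
      intro x hx
      obtain ⟨a, ha⟩ := h3 ⟨x, hx⟩
      replace ha := congrArg Subtype.val ha
      rw [AddSubmonoidClass.coe_finsetSum] at ha
      simp only [coe_aeval_restrict H f hf] at ha
      rw [ha]
      exact Submodule.sum_mem _ fun i _ => hpoly _ _ (hg i)
    refine eq_top_iff.2 fun v _ => ?_
    obtain ⟨x, hx, y, hy, rfl⟩ := exists_fixed_add_I_smul hC v
    exact S.add_mem (hfix x hx) (S.smul_mem _ (hfix y hy))

/-! ### Jordan chains and their conjugates. -/

/-- The Jordan chain `(H - z) ^ (k - 1) u, …, (H - z) u, u`. -/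
noncomputable def jordanChain (H : Module.End ℂ V) (z : ℂ) (k : ℕ) (u : V) (a : Fin k) : V :=
  ((H - algebraMap ℂ _ z) ^ (k - 1 - (a : ℕ))) u

theorem apply_jordanChain {H : Module.End ℂ V} {z : ℂ} {k : ℕ} {u : V}
    (hu : ((H - algebraMap ℂ _ z) ^ k) u = 0) (a : Fin k) :
    H (jordanChain H z k u a) = ∑ b, jordanBlock k z b a • jordanChain H z k u b := by
  have hsplit : H (jordanChain H z k u a) = z • jordanChain H z k u a +
      ((H - algebraMap ℂ _ z) ^ (k - a)) u := by
    have : k - (a : ℕ) = (k - 1 - a) + 1 := by omega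
    rw [this, pow_succ']
    simp [jordanChain, Module.algebraMap_end_apply]
  have hentry : ∀ b : Fin k, jordanBlock k z b a • jordanChain H z k u b =
      (if b = a then z • jordanChain H z k u a else 0) +
      (if (b : ℕ) + 1 = a then ((H - algebraMap ℂ _ z) ^ (k - a)) u else 0) := by
    intro b
    by_cases hb : b = a
    · simp [jordanBlock, hb]
    · by_cases hb' : (b : ℕ) + 1 = a
      · have : k - 1 - (b : ℕ) = k - a := by omega
        simp [jordanBlock, hb, hb', jordanChain, this]
      · simp [jordanBlock, hb, hb']
  rw [hsplit, Finset.sum_congr rfl fun b _ => hentry b, Finset.sum_add_distrib,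
    Finset.sum_ite_eq' Finset.univ a]
  simp only [Finset.mem_univ, if_true]
  congr 1
  -- The first column has no superdiagonal entry; its extra term is `(H - z) ^ k u = 0`.
  by_cases ha : (a : ℕ) = 0
  · simp [ha, hu]
  · rw [Finset.sum_eq_single (⟨a - 1, by omega⟩ : Fin k)]
    · rw [if_pos (by simp; omega)]
    · intro b _ hb
      rw [if_neg]
      intro h
      exact hb (Fin.ext (by simp; omega))
    · simp

/-- The last vector of the chain is `u`; for `k = 0` the chain is empty, but then `u = 0`. -/
theorem mem_of_jordanChain_mem {H : Module.End ℂ V} {z : ℂ} {k : ℕ} {u : V} {S : Submodule ℂ V}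
    (hu : ((H - algebraMap ℂ _ z) ^ k) u = 0) (h : ∀ a, jordanChain H z k u a ∈ S) : u ∈ S := by
  rcases Nat.eq_zero_or_pos k with rfl | hk
  · have : u = 0 := by simpa using hu
    simp [this]
  · simpa [jordanChain] using h ⟨k - 1, by omega⟩

theorem conj_pow_sub_apply {C : V →ₗ⋆[ℂ] V} {H : Module.End ℂ V}
    (hH : ∀ x, C (H x) = H (C x)) (z : ℂ) (k : ℕ) (x : V) :
    C (((H - algebraMap ℂ _ z) ^ k) x) =
      ((H - algebraMap ℂ _ (starRingEnd ℂ z)) ^ k) (C x) := by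
  induction k generalizing x with
  | zero => simp
  | succ k ih =>
    rw [pow_succ, pow_succ, Module.End.mul_apply, Module.End.mul_apply, ih]
    simp [Module.algebraMap_end_apply, hH]

theorem conj_jordanChain {C : V →ₗ⋆[ℂ] V} {H : Module.End ℂ V}
    (hH : ∀ x, C (H x) = H (C x)) (z : ℂ) (k : ℕ) (u : V) (a : Fin k) :
    C (jordanChain H z k u a) = jordanChain H (starRingEnd ℂ z) k (C u) a :=
  conj_pow_sub_apply hH z _ u

open Polynomial in
/-- A vector lies in an invariant subspace as soon as its images under `(H - z) ^ k` and
`(H - w) ^ k` do, for `z ≠ w`. -/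
theorem mem_of_pow_sub_apply_mem {H : Module.End ℂ V} {S : Submodule ℂ V}
    (hS : ∀ x ∈ S, H x ∈ S) {z w : ℂ} (hzw : z ≠ w) (k : ℕ) {g : V}
    (hz : ((H - algebraMap ℂ _ z) ^ k) g ∈ S) (hw : ((H - algebraMap ℂ _ w) ^ k) g ∈ S) :
    g ∈ S := by
  have hpoly : ∀ (q : ℂ[X]) (x : V), x ∈ S → aeval H q x ∈ S := fun q x hx =>
    aeval_apply_smul_mem_of_le_comap' (A := Module.End ℂ V) hx q H hS
  -- A Bézout relation evaluated at `H` writes `g` through its two images.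
  obtain ⟨a, b, hab⟩ : IsCoprime ((X - C z) ^ k) ((X - C w) ^ k) :=
    (isCoprime_X_sub_C_of_isUnit_sub (.mk0 _ (sub_ne_zero.2 hzw))).pow
  have h := congrArg (fun q => aeval H q g) hab
  simp only [map_add, map_mul, map_pow, map_sub, aeval_X, aeval_C, map_one, LinearMap.add_apply,
    Module.End.mul_apply, Module.End.one_apply] at h
  rw [← h]
  exact S.add_mem (hpoly _ _ hz) (hpoly _ _ hw)

end Complex

end PTSymm

namespace PTSymm

/-! ### Assembling the chains into a basis. -/

section Blocks

open Matrix

variable {V : Type*} [AddCommGroup V] [Module ℂ V]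

theorem sum_blockDiagonal'_smul {ι : Type*} [Fintype ι] [DecidableEq ι] {κ : ι → Type*}
    [∀ i, Fintype (κ i)] (M : ∀ i, Matrix (κ i) (κ i) ℂ) (w : (Σ i, κ i) → V) (i : ι) (a : κ i) :
    ∑ x, blockDiagonal' M x ⟨i, a⟩ • w x = ∑ b, M i b a • w ⟨i, b⟩ := by
  rw [Fintype.sum_sigma, Finset.sum_eq_single i]
  · simp
  · intro j _ hj
    exact Finset.sum_eq_zero fun b _ => by rw [blockDiagonal'_apply_ne _ _ _ hj, zero_smul]
  · simp

namespace JordanData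

theorem card_idx (D : JordanData) : Fintype.card D.Idx = D.size :=
  (Fintype.card_congr D.idxEquiv).trans (Fintype.card_fin _)

/-- The matrix `J` in the block indexing. -/
noncomputable def blockJ (D : JordanData) : Matrix D.Idx D.Idx ℂ :=
  fromBlocks
    (blockDiagonal' fun i => fromBlocks
      (jordanBlock (D.m i) (D.μ i)) 0
      0 (jordanBlock (D.m i) (starRingEnd ℂ (D.μ i)))) 0
    0 (blockDiagonal' fun j => jordanBlock (D.k j) (D.lam j : ℂ))

/-- The matrix `K` in the block indexing. -/
def blockK (D : JordanData) : Matrix D.Idx D.Idx ℂ :=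
  fromBlocks
    (blockDiagonal' fun i => fromBlocks
      (0 : Matrix (Fin (D.m i)) (Fin (D.m i)) ℂ) 1
      1 (0 : Matrix (Fin (D.m i)) (Fin (D.m i)) ℂ)) 0
    0 (blockDiagonal' fun j => (1 : Matrix (Fin (D.k j)) (Fin (D.k j)) ℂ))

/-- The Jordan chains generated by `u i` and `C (u i)` for the conjugate pairs and by `v j` for the
real blocks. -/
noncomputable def chains (D : JordanData) (C : V →ₗ⋆[ℂ] V) (H : Module.End ℂ V)
    (u : Fin D.p → V) (v : Fin D.q → V) : D.Idx → V
  | Sum.inl ⟨i, Sum.inl a⟩ => jordanChain H (D.μ i) (D.m i) (u i) a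
  | Sum.inl ⟨i, Sum.inr a⟩ => jordanChain H (starRingEnd ℂ (D.μ i)) (D.m i) (C (u i)) a
  | Sum.inr ⟨j, a⟩ => jordanChain H (D.lam j) (D.k j) (v j) a

variable {D : JordanData} {C : V →ₗ⋆[ℂ] V} {H : Module.End ℂ V}
  {u : Fin D.p → V} {v : Fin D.q → V}

theorem apply_chains (hH : ∀ x, C (H x) = H (C x))
    (hu : ∀ i, ((H - algebraMap ℂ _ (D.μ i)) ^ D.m i) (u i) = 0)
    (hv : ∀ j, ((H - algebraMap ℂ _ (D.lam j : ℂ)) ^ D.k j) (v j) = 0) (x : D.Idx) :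
    H (D.chains C H u v x) = ∑ y, D.blockJ y x • D.chains C H u v y := by
  have hCu : ∀ i, ((H - algebraMap ℂ _ (starRingEnd ℂ (D.μ i))) ^ D.m i) (C (u i)) = 0 :=
    fun i => by rw [← conj_pow_sub_apply hH, hu, map_zero]
  rcases x with ⟨i, a | a⟩ | ⟨j, a⟩
  · simp only [blockJ, Fintype.sum_sum_type, fromBlocks_apply₁₁, fromBlocks_apply₂₁, Matrix.zero_apply,
      zero_smul, Finset.sum_const_zero, add_zero]
    rw [sum_blockDiagonal'_smul _ fun x => D.chains C H u v (Sum.inl x)]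
    simpa [chains] using apply_jordanChain (hu i) a
  · simp only [blockJ, Fintype.sum_sum_type, fromBlocks_apply₁₁, fromBlocks_apply₂₁, Matrix.zero_apply,
      zero_smul, Finset.sum_const_zero, add_zero]
    rw [sum_blockDiagonal'_smul _ fun x => D.chains C H u v (Sum.inl x)]
    simpa [chains] using apply_jordanChain (hCu i) a
  · simp only [blockJ, Fintype.sum_sum_type, fromBlocks_apply₁₂, fromBlocks_apply₂₂, Matrix.zero_apply,
      zero_smul, Finset.sum_const_zero, zero_add]
    rw [sum_blockDiagonal'_smul _ fun x => D.chains C H u v (Sum.inr x)]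
    simpa [chains] using apply_jordanChain (hv j) a

theorem conj_chains (hC : ∀ x, C (C x) = x) (hH : ∀ x, C (H x) = H (C x))
    (hv : ∀ j, C (v j) = v j) (x : D.Idx) :
    C (D.chains C H u v x) = ∑ y, D.blockK y x • D.chains C H u v y := by
  rcases x with ⟨i, a | a⟩ | ⟨j, a⟩
  · simp only [blockK, Fintype.sum_sum_type, fromBlocks_apply₁₁, fromBlocks_apply₂₁, Matrix.zero_apply,
      zero_smul, Finset.sum_const_zero, add_zero]
    rw [sum_blockDiagonal'_smul _ fun x => D.chains C H u v (Sum.inl x)]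
    simp [chains, conj_jordanChain hH, one_apply]
  · simp only [blockK, Fintype.sum_sum_type, fromBlocks_apply₁₁, fromBlocks_apply₂₁, Matrix.zero_apply,
      zero_smul, Finset.sum_const_zero, add_zero]
    rw [sum_blockDiagonal'_smul _ fun x => D.chains C H u v (Sum.inl x)]
    simp [chains, conj_jordanChain hH, one_apply, hC]
  · simp only [blockK, Fintype.sum_sum_type, fromBlocks_apply₁₂, fromBlocks_apply₂₂, Matrix.zero_apply,
      zero_smul, Finset.sum_const_zero, zero_add]
    rw [sum_blockDiagonal'_smul _ fun x => D.chains C H u v (Sum.inr x)]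
    simp [chains, conj_jordanChain hH, one_apply, hv]

/-- Canonical form of an endomorphism commuting with an anti-linear involution, on vectors. -/
theorem exists_basis [FiniteDimensional ℂ V] (hC : ∀ x, C (C x) = x)
    (hH : ∀ x, C (H x) = H (C x)) :
    ∃ (D : JordanData) (_ : D.size = Module.finrank ℂ V) (w : Module.Basis D.Idx ℂ V),
      (∀ x, H (w x) = ∑ y, D.blockJ y x • w y) ∧ (∀ x, C (w x) = ∑ y, D.blockK y x • w y) := by
  classical
  obtain ⟨ι, _, z, e, g, hg, h1, h2, hgen, hdim⟩ := exists_fixed_generators hC hH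
  -- The decomposition may contain exponents `e i = 0`. Their generators vanish, and they are
  -- dropped since block sizes must be positive.
  let A := {i : ι // (z i).im ≠ 0 ∧ 0 < e i}
  let B := {i : ι // (z i).im = 0 ∧ 0 < e i}
  let φ : Fin (Fintype.card A) ≃ A := (Fintype.equivFin A).symm
  let ψ : Fin (Fintype.card B) ≃ B := (Fintype.equivFin B).symm
  let D : JordanData :=
    { p := Fintype.card A
      q := Fintype.card B
      m := fun i => e (φ i)
      k := fun j => e (ψ j)
      μ := fun i => z (φ i)
      lam := fun j => (z (ψ j)).re
      m_pos := fun i => (φ i).2.2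
      k_pos := fun j => (ψ j).2.2
      μ_nonreal := fun i => (φ i).2.1 }
  -- Applying the conjugate factor leaves a vector killed by `(H - μ) ^ m` alone.
  let u : Fin D.p → V := fun i =>
    ((H - algebraMap ℂ _ (starRingEnd ℂ (D.μ i))) ^ D.m i) (g (φ i))
  let v : Fin D.q → V := fun j => g (ψ j)
  have hu : ∀ i, ((H - algebraMap ℂ _ (D.μ i)) ^ D.m i) (u i) = 0 :=
    fun i => h2 (φ i) (φ i).2.1
  have hlam : ∀ j, (D.lam j : ℂ) = z (ψ j) := fun j =>
    Complex.ext rfl (by simp [(ψ j).2.1])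
  have hv : ∀ j, ((H - algebraMap ℂ _ (D.lam j : ℂ)) ^ D.k j) (v j) = 0 :=
    fun j => by rw [hlam]; exact h1 (ψ j) (ψ j).2.1
  have hCu : ∀ i, C (u i) = ((H - algebraMap ℂ _ (D.μ i)) ^ D.m i) (g (φ i)) := fun i => by
    simp only [u]
    rw [conj_pow_sub_apply hH, hg, Complex.conj_conj]
  have hsize : D.size ≤ Module.finrank ℂ V := by
    refine le_trans ?_ hdim
    -- `F i` is the number of chain vectors contributed by `g i`; the retained indices embed in `ι`
    -- by `θ`.
    let F : ι → ℕ := fun i => (if (z i).im = 0 then 1 else 2) * e i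
    let θ : Fin D.p ⊕ Fin D.q → ι := Sum.elim (fun i => (φ i : ι)) fun j => (ψ j : ι)
    have hθ : Function.Injective θ := by
      refine Function.Injective.sumElim (Subtype.val_injective.comp φ.injective)
        (Subtype.val_injective.comp ψ.injective) fun i j h => (φ i).2.1 ?_
      rw [h]
      exact (ψ j).2.1
    calc D.size = ∑ x, F (θ x) := by
          rw [Fintype.sum_sum_type]
          refine congrArg₂ (· + ·) (Finset.sum_congr rfl fun i _ => ?_)
            (Finset.sum_congr rfl fun j _ => ?_)
          · simp [F, θ, D, (φ i).2.1, two_mul]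
          · simp [F, θ, D, (ψ j).2.1]
      _ = ∑ i ∈ Finset.univ.image θ, F i := (Finset.sum_image hθ.injOn).symm
      _ ≤ ∑ i, F i := Finset.sum_le_sum_of_subset (Finset.subset_univ _)
  let w := D.chains C H u v
  have hw := apply_chains hH hu hv
  have hspan : Submodule.span ℂ (Set.range w) = ⊤ := by
    set S := Submodule.span ℂ (Set.range w) with hSdef
    have hmem : ∀ x, w x ∈ S := fun x => Submodule.subset_span ⟨x, rfl⟩
    have hS : ∀ x ∈ S, H x ∈ S := by
      suffices S ≤ S.comap H from this
      rw [hSdef, Submodule.span_le]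
      rintro _ ⟨x, rfl⟩
      refine Submodule.mem_comap.2 ?_
      rw [hw x]
      exact Submodule.sum_mem _ fun y _ => Submodule.smul_mem _ _ (hmem y)
    refine hgen S hS fun i => ?_
    by_cases him : (z i).im = 0
    · rcases Nat.eq_zero_or_pos (e i) with he | he
      · have := h1 i him
        rw [he] at this
        simp_all
      · obtain ⟨j, hj⟩ := ψ.surjective ⟨i, him, he⟩
        have : v j ∈ S := mem_of_jordanChain_mem (hv j) fun a => hmem (Sum.inr ⟨j, a⟩)
        simpa [v, hj] using this
    · rcases Nat.eq_zero_or_pos (e i) with he | he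
      · have := h2 i him
        rw [he] at this
        simp_all
      · obtain ⟨j, hj⟩ := φ.surjective ⟨i, him, he⟩
        have hju : u j ∈ S := mem_of_jordanChain_mem (hu j) fun a => hmem (Sum.inl ⟨j, Sum.inl a⟩)
        have hjC : C (u j) ∈ S :=
          mem_of_jordanChain_mem (by rw [← conj_pow_sub_apply hH, hu, map_zero])
            fun a => hmem (Sum.inl ⟨j, Sum.inr a⟩)
        rw [hCu] at hjC
        have hne : D.μ j ≠ starRingEnd ℂ (D.μ j) :=
          fun h => D.μ_nonreal j (Complex.conj_eq_iff_im.1 h.symm)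
        have := mem_of_pow_sub_apply_mem hS hne _ hjC hju
        rwa [hj] at this
  have hcard : Fintype.card D.Idx = D.size := card_idx D
  have hfin : Module.finrank ℂ V ≤ Fintype.card D.Idx := by
    rw [← finrank_top, ← hspan]
    exact finrank_range_le_card w
  have hrank : D.size = Module.finrank ℂ V := le_antisymm hsize (hcard ▸ hfin)
  refine ⟨D, hrank, basisOfTopLeSpanOfCardEqFinrank w hspan.ge (hcard.trans hrank), fun x => ?_,
    fun x => ?_⟩
  · rw [coe_basisOfTopLeSpanOfCardEqFinrank]
    exact hw x
  · rw [coe_basisOfTopLeSpanOfCardEqFinrank]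
    exact conj_chains hC hH (fun j => hg (ψ j)) x

end JordanData

end Blocks

/-! ### Translation into matrices. -/

/-- The coordinates of the image of a vector under an anti-linear map. -/
theorem antilinearMatrix_mulVec {n : ℕ} (b : Module.Basis (Fin n) ℂ (Cn n))
    (T : Cn n →ₗ⋆[ℂ] Cn n) (x : Cn n) :
    (antilinearMatrix b T).mulVec (fun i => starRingEnd ℂ (b.repr x i)) = b.repr (T x) := by
  have h : T x = ∑ j, starRingEnd ℂ (b.repr x j) • T (b j) := by
    conv_lhs => rw [← b.sum_repr x, map_sum]
    simp only [map_smulₛₗ]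
  ext i
  simp [h, Matrix.mulVec, dotProduct, antilinearMatrix, mul_comm]

end PTSymm

theorem mainTheorem2 (n : ℕ)
    (b : Module.Basis (Fin n) ℂ (PTSymm.Cn n))
    (P : PTSymm.Cn n →ₗ[ℂ] PTSymm.Cn n)
    (T : PTSymm.Cn n →ₗ⋆[ℂ] PTSymm.Cn n)
    (H : PTSymm.Cn n →ₗ[ℂ] PTSymm.Cn n)
    (hPT : PTSymm.IsPTSymmetric P T H) :
    ∃ (D : PTSymm.JordanData) (hD : D.size = n) (Ψ : Matrix (Fin n) (Fin n) ℂ),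
      IsUnit Ψ ∧
      Ψ⁻¹ * LinearMap.toMatrix b b H * Ψ =
        Matrix.reindex (finCongr hD) (finCongr hD) D.J ∧
      Ψ⁻¹ * (LinearMap.toMatrix b b P * PTSymm.antilinearMatrix b T) * PTSymm.conjMatrix Ψ =
        Matrix.reindex (finCongr hD) (finCongr hD) D.K := by
  obtain ⟨D, hD, w, hJ, hK⟩ := PTSymm.JordanData.exists_basis (C := P.comp T) (H := H)
    (fun x => by
      simp only [LinearMap.comp_apply]
      rw [← hPT.commute, hPT.timeReversal, hPT.parity])
    (fun x => (hPT.symmetric x).symm)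
  rw [finrank_euclideanSpace_fin] at hD
  let e : D.Idx ≃ Fin n := D.idxEquiv.trans (finCongr hD)
  let B : Module.Basis (Fin n) ℂ (PTSymm.Cn n) := w.reindex e
  have hinv : B.toMatrix b * b.toMatrix B = 1 := B.toMatrix_mul_toMatrix_flip b
  have hΨ : (b.toMatrix B)⁻¹ = B.toMatrix b := Matrix.inv_eq_left_inv hinv
  refine ⟨D, hD, b.toMatrix B, (Matrix.isUnit_iff_isUnit_det _).2 (Matrix.isUnit_det_of_left_inverse hinv), ?_, ?_⟩
  · rw [hΨ, basis_toMatrix_mul_linearMap_toMatrix_mul_basis_toMatrix]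
    change _ = Matrix.reindex e e D.blockJ
    ext i j
    have hcol : H (B j) = ∑ l, Matrix.reindex e e D.blockJ l j • B l := by
      rw [← e.sum_comp]
      simpa only [B, Module.Basis.reindex_apply, Matrix.reindex_apply, Matrix.submatrix_apply,
        Equiv.symm_apply_apply] using hJ (e.symm j)
    rw [LinearMap.toMatrix_apply, hcol, B.repr_sum_self]
  -- Column `j` of both sides holds the `b`-coordinates of `P (T (B j))`; anti-linearity of `T`
  -- accounts for the conjugate of `Ψ`.
  · have hconj : LinearMap.toMatrix b b P * PTSymm.antilinearMatrix b T *
        PTSymm.conjMatrix (b.toMatrix B) = b.toMatrix B * Matrix.reindex e e D.blockK := by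
      ext i j
      have hcol : P (T (B j)) = ∑ l, Matrix.reindex e e D.blockK l j • B l := by
        rw [← e.sum_comp]
        simpa only [B, Module.Basis.reindex_apply, Matrix.reindex_apply, Matrix.submatrix_apply,
          Equiv.symm_apply_apply, LinearMap.comp_apply] using hK (e.symm j)
      have h := congrFun (LinearMap.toMatrix_mulVec_repr b b P (T (B j))) i
      rw [← PTSymm.antilinearMatrix_mulVec, Matrix.mulVec_mulVec, hcol] at h
      simpa [Matrix.mul_apply, Matrix.mulVec, dotProduct, PTSymm.conjMatrix,
        Module.Basis.toMatrix_apply, mul_comm] using h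
    rw [hΨ, Matrix.mul_assoc, hconj, ← Matrix.mul_assoc, hinv, Matrix.one_mul]
    rfl
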